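/- Let $X_1,X_2,\dots$ be i.i.d. random vectors in $\mathbb R^2$ with probability density $f$, and let $\phi(t)=\int_{\mathbb R^2}e^{it'x}f(x)\,dx$. For $n\ge 2$ let $\mathcal C_n(t)=n^{-1}\sum_{j=1}^n e^{it'X_j}$ be the empirical characteristic function, let $A_n\subseteq\mathbb R^2$ be the (measurable, possibly data-dependent) set of acceptable frequencies, and put $$\hat\kappa_n(t)=\frac{n}{2(n-1)}\left[1+\sqrt{1-\frac{4(n-1)}{|n\,\mathcal C_n(t)|^2}}\,\right]I_{A_n}(t),\qquad \hat K_n(x)=\frac1{(2\pi)^2}\int_{\mathbb R^2}e^{-it'x}\hat\kappa_n(t)\,dt,\qquad \hat f_n(x)=\frac1n\sum_{j=1}^n\hat K_n(x-X_j),$$ where the square root of a negative number is read as $0$ (this plays no role if $A_n$ contains only frequencies with $|n\,\mathcal C_n(t)|^2\ge 4(n-1)$). Let $\mathcal V$ denote Lebesgue measure on $\mathbb R^2$. Assume that $f$ is square integrable, that $\phi$ is integrable, and that there are non-random measurable sets $D_n$ (with $D_n=A_n$ if the $A_n$ are themselves non-random) such that almost surely $A_n\subseteq D_n$ for all large $n$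 and $$\mathcal V(A_n)\to\infty\ \text{ a.s.},\qquad \mathcal V(D_n)/\sqrt n\to0,\qquad \mathcal V\big(\{t\notin A_n:\ |t|<R\}\big)\to0\ \text{ for every } R>0,\ \text{a.s.},\qquad n\to\infty .$$ Then: 1. There is a Lebesgue-null set $N\subset\mathbb R^2$ such that, almost surely, $\hat f_n(x)\to f(x)$ for every $x\notin N$. 2. Let $\chi$ be the support of $f$, that is, the set of points all of whose neighbourhoods have positive probability under $f$. If $f$ is continuous on $\chi$, then almost surely $\hat f_n\to f$ uniformly on $\chi$; if moreover $f=0$ outside $\chi$ (in particular if $f$ is continuous on $\mathbb R^2$), then almost surely $\hat f_n\to f$ uniformly on $\mathbb R^2$. -/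

import Mathlib

open MeasureTheory ProbabilityTheory Filter Topology
open scoped ENNReal RealInnerProductSpace

noncomputable section

/-- The Euclidean plane, used both as data space and as frequency space. -/
abbrev Plane : Type := EuclideanSpace ℝ (Fin 2)

/-- The (absolutely continuous) law on the plane with density `f`. -/
def densityLaw (f : Plane → ℝ) : Measure Plane :=
  volume.withDensity (fun x => ENNReal.ofReal (f x))

/-- The support of a density: the topological support of its law, that is, the points all of whose
neighbourhoods have positive mass. -/
def densitySupport (f : Plane → ℝ) : Set Plane := (densityLaw f).support

/-- The Fourier transform `φ(t) = ∫ exp(i t'x) f(x) dx` of a density (its characteristic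
function). -/
def densityFourier (f : Plane → ℝ) (t : Plane) : ℂ :=
  ∫ x : Plane, Complex.exp (Complex.I * (⟪t, x⟫ : ℝ)) * (f x : ℂ)

/-- The empirical characteristic function `n⁻¹ ∑ⱼ exp(i t'Xⱼ)` of the first `n` data points. -/
def ecf (X : ℕ → Plane) (n : ℕ) (t : Plane) : ℂ :=
  (n : ℂ)⁻¹ * ∑ j ∈ Finset.range n, Complex.exp (Complex.I * (⟪t, X j⟫ : ℝ))

open Classical in
/-- The optimal transform kernel
`n / (2(n-1)) * [1 + √(1 - 4(n-1) / |n C(t)|²)] * I_A(t)`.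
`Real.sqrt` is `0` on negative numbers, so that on the part of `A` where
`|n C(t)|² < 4(n-1)` (if there is any) the square root is read as `0`. -/
def sceTransformKernel (X : ℕ → Plane) (A : Set Plane) (n : ℕ) (t : Plane) : ℝ :=
  if t ∈ A then
    (n : ℝ) / (2 * ((n : ℝ) - 1)) *
      (1 + Real.sqrt (1 - 4 * ((n : ℝ) - 1) / ‖(n : ℂ) * ecf X n t‖ ^ 2))
  else 0

/-- The optimal kernel: the transform kernel taken back to the data space,
`K(x) = (2π)⁻² ∫ exp(-i t'x) κ(t) dt`. -/
def sceKernel (X : ℕ → Plane) (A : Set Plane) (n : ℕ) (x : Plane) : ℂ :=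
  ((2 * Real.pi : ℝ) : ℂ)⁻¹ ^ 2 *
    ∫ t : Plane, Complex.exp (-Complex.I * (⟪t, x⟫ : ℝ)) * (sceTransformKernel X A n t : ℂ)

/-- The self-consistent estimator `n⁻¹ ∑ⱼ K(x - Xⱼ)` from the first `n` data points, with set of
acceptable frequencies `A`. It is real whenever `A = -A`. -/
def sce (X : ℕ → Plane) (A : Set Plane) (n : ℕ) (x : Plane) : ℂ :=
  (n : ℂ)⁻¹ * ∑ j ∈ Finset.range n, sceKernel X A n (x - X j)

end

/-
The estimator `f̂ₙ` is the inversion integral of `κ̂ₙ Cₙ`, so it suffices that `κ̂ₙ Cₙ → φ` in `L¹`.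
On the acceptable frequencies `|κ̂ₙ Cₙ - Cₙ| ≤ 4 / √n`, which integrates to `o(1)` because
`𝒱(Dₙ) = o(√n)`, and the mass of `φ` outside `Aₙ` vanishes by dominated convergence. What remains
is `∫_{Dₙ} |Cₙ - φ|`. Restricted to `Dₙ`, the function `Cₙ - φ` is the mean of `n` centred i.i.d.
vectors of `L²(Dₙ)` of norm at most `2 √𝒱(Dₙ)`; since `φ` is integrable, `f` is bounded, and
Plancherel's identity bounds the weak variance of these vectors independently of `Dₙ`. A
Bernstein inequality in Hilbert space then gives tails of order `exp(-c √n)`, which are summable,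
and Borel–Cantelli concludes.
-/

section Concentration

variable {Ω : Type*} [MeasurableSpace Ω] {P : Measure Ω}

lemma lintegral_fun_add_of_indepFun {G : Type*} [MeasurableSpace G] [Add G] [MeasurableAdd₂ G]
    [IsFiniteMeasure P] {S Y : Ω → G} (hS : Measurable S) (hY : Measurable Y)
    (hSY : IndepFun S Y P) {F : G → ℝ≥0∞} (hF : Measurable F) :
    ∫⁻ ω, F (S ω + Y ω) ∂P = ∫⁻ ω, ∫⁻ ω', F (S ω + Y ω') ∂P ∂P := by
  have hF_add : Measurable fun p : G × G => F (p.1 + p.2) := by fun_prop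
  calc ∫⁻ ω, F (S ω + Y ω) ∂P
      = ∫⁻ p, F (p.1 + p.2) ∂(P.map fun ω => (S ω, Y ω)) :=
        (lintegral_map hF_add (hS.prodMk hY)).symm
    _ = ∫⁻ s, ∫⁻ z, F (s + z) ∂(P.map Y) ∂(P.map S) := by
        rw [(indepFun_iff_map_prod_eq_prod_map_map hS.aemeasurable hY.aemeasurable).1 hSY,
          lintegral_prod _ hF_add.aemeasurable]
    _ = ∫⁻ ω, ∫⁻ z, F (S ω + z) ∂(P.map Y) ∂P :=
        lintegral_map hF_add.lintegral_prod_right' hS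
    _ = ∫⁻ ω, ∫⁻ ω', F (S ω + Y ω') ∂P ∂P :=
        lintegral_congr fun ω => lintegral_map (by fun_prop) hY

variable {H : Type*} [NormedAddCommGroup H]

/-- The function `√(b² + ‖s‖²)`, a smooth substitute for the norm: the logarithm of the potential
in the exponential moment bounds for sums of random vectors. -/
noncomputable def smoothNorm (b : ℝ) (s : H) : ℝ := √(b ^ 2 + ‖s‖ ^ 2)

@[fun_prop]
lemma measurable_smoothNorm [MeasurableSpace H] [OpensMeasurableSpace H] (b : ℝ) :
    Measurable (smoothNorm b : H → ℝ) := by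
  unfold smoothNorm
  fun_prop

lemma norm_le_smoothNorm (b : ℝ) (s : H) : ‖s‖ ≤ smoothNorm b s :=
  Real.le_sqrt_of_sq_le (le_add_of_nonneg_left (sq_nonneg b))

lemma le_smoothNorm (b : ℝ) (s : H) : b ≤ smoothNorm b s :=
  Real.le_sqrt_of_sq_le (le_add_of_nonneg_right (sq_nonneg ‖s‖))

lemma smoothNorm_zero {b : ℝ} (hb : 0 ≤ b) : smoothNorm b (0 : H) = b := by
  simp [smoothNorm, Real.sqrt_sq hb]

variable [InnerProductSpace ℝ H]

lemma smoothNorm_add_le {b : ℝ} (hb : 0 < b) (s z : H) :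
    smoothNorm b (s + z) ≤
      smoothNorm b s + ⟪s, z⟫ / smoothNorm b s + ‖z‖ ^ 2 / (2 * b) := by
  set a := smoothNorm b s with ha
  set q := smoothNorm b (s + z) with hq
  have ha_pos : 0 < a := hb.trans_le (le_smoothNorm b s)
  have hq_sq : q ^ 2 = a ^ 2 + 2 * ⟪s, z⟫ + ‖z‖ ^ 2 := by
    rw [hq, ha, smoothNorm, smoothNorm, Real.sq_sqrt (by positivity), Real.sq_sqrt (by positivity),
      norm_add_sq_real]
    ring
  calc q ≤ q + (q - a) ^ 2 / (2 * a) := le_add_of_nonneg_right (by positivity)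
    _ = a + (q ^ 2 - a ^ 2) / (2 * a) := by field_simp; ring
    _ = a + ⟪s, z⟫ / a + ‖z‖ ^ 2 / (2 * a) := by rw [hq_sq]; field_simp; ring
    _ ≤ a + ⟪s, z⟫ / a + ‖z‖ ^ 2 / (2 * b) := by gcongr; exact le_smoothNorm b s

lemma lintegral_exp_le_exp_integral_sq [IsProbabilityMeasure P] {Y : Ω → ℝ}
    (hY : AEStronglyMeasurable Y P) (hY_le : ∀ᵐ ω ∂P, |Y ω| ≤ 1) (hY_mean : ∫ ω, Y ω ∂P = 0) :
    ∫⁻ ω, ENNReal.ofReal (Real.exp (Y ω)) ∂P ≤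
      ENNReal.ofReal (Real.exp (∫ ω, Y ω ^ 2 ∂P)) := by
  have hY_int : Integrable Y P := .of_bound hY 1 hY_le
  have hY_sq_int : Integrable (fun ω => Y ω ^ 2) P :=
    .of_bound (hY.pow 2) 1 (hY_le.mono fun ω hω => by simpa using hω)
  have hexp_le : ∀ᵐ ω ∂P, Real.exp (Y ω) ≤ 1 + Y ω + Y ω ^ 2 := by
    filter_upwards [hY_le] with ω hω
    linarith [(abs_le.1 (Real.abs_exp_sub_one_sub_id_le hω)).2]
  have hbound_int : Integrable (fun ω => 1 + Y ω + Y ω ^ 2) P :=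
    ((integrable_const 1).add hY_int).add hY_sq_int
  calc ∫⁻ ω, ENNReal.ofReal (Real.exp (Y ω)) ∂P
      ≤ ∫⁻ ω, ENNReal.ofReal (1 + Y ω + Y ω ^ 2) ∂P :=
        lintegral_mono_ae (hexp_le.mono fun ω hω => ENNReal.ofReal_le_ofReal hω)
    _ = ENNReal.ofReal (∫ ω, (1 + Y ω + Y ω ^ 2) ∂P) :=
        (ofReal_integral_eq_lintegral_ofReal hbound_int
          (hexp_le.mono fun ω hω => (Real.exp_pos _).le.trans hω)).symm
    _ = ENNReal.ofReal (∫ ω, Y ω ^ 2 ∂P + 1) := by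
        have hadd := integral_add (by fun_prop : Integrable (fun ω => 1 + Y ω) P) hY_sq_int
        rw [hadd, integral_add (integrable_const 1) hY_int, hY_mean]
        simp [add_comm]
    _ ≤ ENNReal.ofReal (Real.exp (∫ ω, Y ω ^ 2 ∂P)) :=
        ENNReal.ofReal_le_ofReal (Real.add_one_le_exp _)

/-- A centred random vector of a Hilbert space, almost surely bounded by `L`, with weak variance at
most `v`: every one-dimensional marginal along a unit vector has second moment at most `v`. The
mean is only tested against vectors, so no Bochner integral of `Y` occurs. -/
structure IsCenteredBounded (Y : Ω → H) (P : Measure Ω) (L v : ℝ) : Prop where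
  ae_norm_le : ∀ᵐ ω ∂P, ‖Y ω‖ ≤ L
  integral_inner_eq_zero : ∀ h : H, ∫ ω, ⟪h, Y ω⟫ ∂P = 0
  integral_inner_sq_le : ∀ h : H, ∫ ω, ⟪h, Y ω⟫ ^ 2 ∂P ≤ v * ‖h‖ ^ 2

lemma isCenteredBounded_sub_integral [CompleteSpace H] [IsProbabilityMeasure P] {Y : Ω → H}
    {K v : ℝ} (hY : AEStronglyMeasurable Y P) (hY_le : ∀ ω, ‖Y ω‖ ≤ K)
    (hY_var : ∀ h : H, ∫ ω, ⟪h, Y ω⟫ ^ 2 ∂P ≤ v * ‖h‖ ^ 2) :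
    IsCenteredBounded (fun ω => Y ω - ∫ ω', Y ω' ∂P) P (2 * K) v := by
  have hY_int : Integrable Y P := .of_bound hY K (ae_of_all _ hY_le)
  refine ⟨ae_of_all _ fun ω => ?_, fun h => ?_, fun h => ?_⟩
  · have hmean_le : ‖∫ ω', Y ω' ∂P‖ ≤ K := by
      simpa using norm_integral_le_of_norm_le_const (ae_of_all P hY_le)
    linarith [norm_sub_le (Y ω) (∫ ω', Y ω' ∂P), hY_le ω]
  · calc ∫ ω, ⟪h, Y ω - ∫ ω', Y ω' ∂P⟫ ∂P = ⟪h, ∫ ω, (Y ω - ∫ ω', Y ω' ∂P) ∂P⟫ :=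
          integral_inner (hY_int.sub (integrable_const _)) h
      _ = 0 := by rw [integral_sub hY_int (integrable_const _)]; simp
  · have hvar := variance_le_expectation_sq (μ := P) (hY.const_inner (𝕜 := ℝ) (c := h))
    rw [variance_eq_integral hY_int.aestronglyMeasurable.const_inner.aemeasurable,
      integral_inner hY_int] at hvar
    simpa only [inner_sub_right] using hvar.trans (hY_var h)

variable [MeasurableSpace H] [BorelSpace H] {L v l b : ℝ}

lemma IsCenteredBounded.lintegral_exp_inner_le [IsProbabilityMeasure P] {Y : Ω → H}
    (hY : Measurable Y) (hYc : IsCenteredBounded Y P L v) (hv : 0 ≤ v) {h : H} (hh : ‖h‖ ≤ l)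
    (hlL : l * L ≤ 1) :
    ∫⁻ ω, ENNReal.ofReal (Real.exp ⟪h, Y ω⟫) ∂P ≤ ENNReal.ofReal (Real.exp (l ^ 2 * v)) := by
  have hl : 0 ≤ l := (norm_nonneg h).trans hh
  have hinner_le : ∀ᵐ ω ∂P, |⟪h, Y ω⟫| ≤ 1 := by
    filter_upwards [hYc.ae_norm_le] with ω hω
    calc |⟪h, Y ω⟫| ≤ ‖h‖ * ‖Y ω‖ := abs_real_inner_le_norm h _
      _ ≤ l * L := by gcongr
      _ ≤ 1 := hlL
  have hinner_sq : ∫ ω, ⟪h, Y ω⟫ ^ 2 ∂P ≤ l ^ 2 * v :=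
    (hYc.integral_inner_sq_le h).trans <| by rw [mul_comm]; gcongr
  have hinner_meas : Measurable fun ω => ⟪h, Y ω⟫ := by fun_prop
  exact (lintegral_exp_le_exp_integral_sq hinner_meas.aestronglyMeasurable hinner_le
    (hYc.integral_inner_eq_zero h)).trans (by gcongr)

lemma IsCenteredBounded.lintegral_exp_smoothNorm_add_le [IsProbabilityMeasure P] {Y : Ω → H}
    (hY : Measurable Y) (hYc : IsCenteredBounded Y P L v) (hv : 0 ≤ v) (hl : 0 ≤ l)
    (hlL : l * L ≤ 1) (hb : 0 < b) (s : H) :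
    ∫⁻ ω, ENNReal.ofReal (Real.exp (l * smoothNorm b (s + Y ω))) ∂P ≤
      ENNReal.ofReal (Real.exp (l ^ 2 * v + l * L ^ 2 / (2 * b))) *
        ENNReal.ofReal (Real.exp (l * smoothNorm b s)) := by
  set a := smoothNorm b s
  have ha : 0 < a := hb.trans_le (le_smoothNorm b s)
  have hh : ‖(l / a) • s‖ ≤ l := by
    rw [norm_smul_of_nonneg (by positivity), div_mul_eq_mul_div, div_le_iff₀ ha]
    gcongr
    exact norm_le_smoothNorm b s
  have hstep : ∀ᵐ ω ∂P, l * smoothNorm b (s + Y ω) ≤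
      ⟪(l / a) • s, Y ω⟫ + (l * a + l * L ^ 2 / (2 * b)) := by
    filter_upwards [hYc.ae_norm_le] with ω hω
    calc l * smoothNorm b (s + Y ω) ≤ l * (a + ⟪s, Y ω⟫ / a + L ^ 2 / (2 * b)) := by
          gcongr
          exact (smoothNorm_add_le hb s _).trans (by gcongr)
      _ = ⟪(l / a) • s, Y ω⟫ + (l * a + l * L ^ 2 / (2 * b)) := by
          rw [real_inner_smul_left]
          ring
  calc ∫⁻ ω, ENNReal.ofReal (Real.exp (l * smoothNorm b (s + Y ω))) ∂P
      ≤ ∫⁻ ω, ENNReal.ofReal (Real.exp ⟪(l / a) • s, Y ω⟫) *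
          ENNReal.ofReal (Real.exp (l * a + l * L ^ 2 / (2 * b))) ∂P := by
        refine lintegral_mono_ae (hstep.mono fun ω hω => ?_)
        rw [← ENNReal.ofReal_mul (Real.exp_nonneg _), ← Real.exp_add]
        gcongr
    _ ≤ ENNReal.ofReal (Real.exp (l ^ 2 * v)) *
          ENNReal.ofReal (Real.exp (l * a + l * L ^ 2 / (2 * b))) := by
        rw [lintegral_mul_const _ (by fun_prop)]
        gcongr
        exact hYc.lintegral_exp_inner_le hY hv hh hlL
    _ = _ := by
        simp only [← ENNReal.ofReal_mul (Real.exp_nonneg _), ← Real.exp_add]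
        ring_nf

variable [SecondCountableTopology H]

variable [IsProbabilityMeasure P] {Z : ℕ → Ω → H}

lemma lintegral_exp_smoothNorm_sum_le (hZ : ∀ j, Measurable (Z j)) (hZ_indep : iIndepFun Z P)
    (hZc : ∀ j, IsCenteredBounded (Z j) P L v) (hv : 0 ≤ v) (hl : 0 ≤ l) (hlL : l * L ≤ 1)
    (hb : 0 < b) (n : ℕ) :
    ∫⁻ ω, ENNReal.ofReal (Real.exp (l * smoothNorm b (∑ j ∈ Finset.range n, Z j ω))) ∂P ≤
      ENNReal.ofReal (Real.exp (n * (l ^ 2 * v + l * L ^ 2 / (2 * b)) + l * b)) := by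
  set c := l ^ 2 * v + l * L ^ 2 / (2 * b)
  induction n with
  | zero => simp [smoothNorm_zero hb.le]
  | succ k ih =>
    let S : Ω → H := ∑ j ∈ Finset.range k, Z j
    have hS : Measurable S := by fun_prop
    have hSZ : IndepFun S (Z k) P := hZ_indep.indepFun_finsetSum_of_notMem hZ (by simp)
    have hF : Measurable fun s : H => ENNReal.ofReal (Real.exp (l * smoothNorm b s)) := by
      fun_prop
    calc ∫⁻ ω, ENNReal.ofReal
          (Real.exp (l * smoothNorm b (∑ j ∈ Finset.range (k + 1), Z j ω))) ∂P
        = ∫⁻ ω, ENNReal.ofReal (Real.exp (l * smoothNorm b (S ω + Z k ω))) ∂P := by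
          simp only [S, Finset.sum_range_succ, Finset.sum_apply]
      _ = ∫⁻ ω, ∫⁻ ω', ENNReal.ofReal (Real.exp (l * smoothNorm b (S ω + Z k ω'))) ∂P ∂P :=
          lintegral_fun_add_of_indepFun hS (hZ k) hSZ hF
      _ ≤ ∫⁻ ω, ENNReal.ofReal (Real.exp c) *
            ENNReal.ofReal (Real.exp (l * smoothNorm b (S ω))) ∂P :=
          lintegral_mono fun ω =>
            (hZc k).lintegral_exp_smoothNorm_add_le (hZ k) hv hl hlL hb (S ω)
      _ ≤ ENNReal.ofReal (Real.exp c) * ENNReal.ofReal (Real.exp (k * c + l * b)) := by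
          rw [lintegral_const_mul _ (by fun_prop)]
          gcongr
          simpa only [S, Finset.sum_apply] using ih
      _ = ENNReal.ofReal (Real.exp ((k + 1 : ℕ) * c + l * b)) := by
          rw [← ENNReal.ofReal_mul (Real.exp_nonneg _), ← Real.exp_add]
          push_cast
          ring_nf

lemma measure_le_norm_sum_le (hZ : ∀ j, Measurable (Z j)) (hZ_indep : iIndepFun Z P)
    (hZc : ∀ j, IsCenteredBounded (Z j) P L v) (hv : 0 ≤ v) (hl : 0 ≤ l) (hlL : l * L ≤ 1)
    (hb : 0 < b) (n : ℕ) (r : ℝ) :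
    P {ω | r ≤ ‖∑ j ∈ Finset.range n, Z j ω‖} ≤
      ENNReal.ofReal (Real.exp (n * (l ^ 2 * v + l * L ^ 2 / (2 * b)) + l * b - l * r)) := by
  let F : H → ℝ≥0∞ := fun s => ENNReal.ofReal (Real.exp (l * smoothNorm b s))
  have hF : Measurable F := by fun_prop
  calc P {ω | r ≤ ‖∑ j ∈ Finset.range n, Z j ω‖}
      ≤ P {ω | ENNReal.ofReal (Real.exp (l * r)) ≤ F (∑ j ∈ Finset.range n, Z j ω)} := by
        refine measure_mono fun ω (hω : r ≤ _) => ENNReal.ofReal_le_ofReal ?_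
        gcongr
        exact hω.trans (norm_le_smoothNorm b _)
    _ ≤ (∫⁻ ω, F (∑ j ∈ Finset.range n, Z j ω) ∂P) / ENNReal.ofReal (Real.exp (l * r)) :=
        meas_ge_le_lintegral_div (by fun_prop) (by simp [Real.exp_pos]) ENNReal.ofReal_ne_top
    _ ≤ _ := by
        rw [Real.exp_sub, ENNReal.ofReal_div_of_pos (Real.exp_pos _)]
        gcongr
        exact lintegral_exp_smoothNorm_sum_le hZ hZ_indep hZc hv hl hlL hb n

/-- The choice `b = r / 4` leaves a quarter of the exponent `l * r`. -/
lemma measureReal_le_norm_sum_le_exp (hZ : ∀ j, Measurable (Z j)) (hZ_indep : iIndepFun Z P)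
    (hZc : ∀ j, IsCenteredBounded (Z j) P L v) (hv : 0 ≤ v) (hl : 0 ≤ l) (hlL : l * L ≤ 1)
    {n : ℕ} {r : ℝ} (hr : 0 < r) (hrL : 8 * n * L ^ 2 ≤ r ^ 2) (hrv : 4 * n * l * v ≤ r) :
    P.real {ω | r ≤ ‖∑ j ∈ Finset.range n, Z j ω‖} ≤ Real.exp (-(l * r / 4)) := by
  refine ENNReal.toReal_le_of_le_ofReal (Real.exp_nonneg _)
    ((measure_le_norm_sum_le hZ hZ_indep hZc hv hl hlL (b := r / 4) (by positivity) n r).trans ?_)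
  have hvariance : n * (l ^ 2 * v) ≤ l * r / 4 := by nlinarith
  have hrange : n * (l * L ^ 2 / (2 * (r / 4))) ≤ l * r / 4 := by
    calc n * (l * L ^ 2 / (2 * (r / 4))) = l * (8 * n * L ^ 2) / (4 * r) := by field_simp; ring
      _ ≤ l * r ^ 2 / (4 * r) := by gcongr
      _ = l * r / 4 := by field_simp
  gcongr
  linarith

end Concentration

section L2

variable {α : Type*} [MeasurableSpace α] {μ : Measure α} {E : Type*} [NormedAddCommGroup E]

lemma L2_norm_sq_eq_integral [InnerProductSpace ℝ E] (F : Lp E 2 μ) :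
    ‖F‖ ^ 2 = ∫ x, ‖F x‖ ^ 2 ∂μ := by
  simp only [← real_inner_self_eq_norm_sq, L2.inner_def]

lemma abs_real_inner_le_norm_inner (F G : Lp ℂ 2 μ) : |⟪F, G⟫| ≤ ‖inner ℂ F G‖ := by
  have hre : ⟪F, G⟫ = (inner ℂ F G).re := by
    rw [L2.inner_def, L2.inner_def]
    exact Complex.reCLM.integral_comp_comm (L2.integrable_inner F G)
  exact hre ▸ Complex.abs_re_le_norm _

lemma integral_norm_le_sqrt_mul_norm [IsFiniteMeasure μ] (F : Lp E 2 μ) :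
    ∫ x, ‖F x‖ ∂μ ≤ √(μ.real Set.univ) * ‖F‖ := by
  have hcmp := eLpNorm_le_eLpNorm_mul_rpow_measure_univ one_le_two (Lp.aestronglyMeasurable F)
  calc ∫ x, ‖F x‖ ∂μ = (eLpNorm F 1 μ).toReal := by
        rw [eLpNorm_one_eq_lintegral_enorm, integral_norm_eq_lintegral_enorm
          (Lp.aestronglyMeasurable F)]
    _ ≤ (eLpNorm F 2 μ * μ Set.univ ^ ((1 : ℝ) / 2)).toReal := by
        refine ENNReal.toReal_mono (by finiteness [Lp.eLpNorm_ne_top F]) (hcmp.trans_eq ?_)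
        norm_num
    _ = √(μ.real Set.univ) * ‖F‖ := by
        rw [ENNReal.toReal_mul, ← ENNReal.toReal_rpow, Real.sqrt_eq_rpow, mul_comm, Lp.norm_def]
        rfl

end L2

section Fourier

open FourierTransform SchwartzMap

variable {V : Type*} [NormedAddCommGroup V] [InnerProductSpace ℝ V] [FiniteDimensional ℝ V]
  [MeasurableSpace V] [BorelSpace V] {E : Type*} [NormedAddCommGroup E]

lemma continuous_fourier_of_integrable [NormedSpace ℂ E] {g : V → E} (hg : Integrable g) :
    Continuous (𝓕 g) :=
  VectorFourier.fourierIntegral_continuous Real.continuous_fourierChar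
    (by exact continuous_inner) hg

lemma integral_fourier_smul_eq [NormedSpace ℂ E] [CompleteSpace E] {ψ : V → ℂ} {g : V → E}
    (hψ : Integrable ψ) (hg : Integrable g) : ∫ x, 𝓕 ψ x • g x = ∫ x, ψ x • 𝓕 g x := by
  simpa using! VectorFourier.integral_fourierIntegral_smul_eq_flip (L := innerₗ V)
    Real.continuous_fourierChar continuous_inner hψ hg

lemma integral_fourierInv_smul_eq [NormedSpace ℂ E] [CompleteSpace E] {ψ : V → ℂ} {g : V → E}
    (hψ : Integrable ψ) (hg : Integrable g) : ∫ x, 𝓕⁻ ψ x • g x = ∫ x, ψ x • 𝓕⁻ g x := by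
  rw [Real.fourierInv_eq_fourier_comp_neg g, ← integral_fourier_smul_eq hψ hg.comp_neg,
    ← integral_neg_eq_self]
  simp [Real.fourierInv_eq_fourier_neg]

lemma ae_eq_of_integral_schwartz_smul_eq [NormedSpace ℂ E] [CompleteSpace E] {f g : V → E}
    (hf : LocallyIntegrable f) (hg : LocallyIntegrable g)
    (h : ∀ ψ : 𝓢(V, ℂ), ∫ x, ψ x • f x = ∫ x, ψ x • g x) : f =ᵐ[volume] g := by
  refine ae_eq_of_integral_contDiff_smul_eq hf hg fun η hη hη_supp => ?_
  have hη_supp' : HasCompactSupport fun x => (η x : ℂ) := hη_supp.comp_left Complex.ofReal_zero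
  let ψ : 𝓢(V, ℂ) := hη_supp'.toSchwartzMap (Complex.ofRealCLM.contDiff.comp hη)
  have hψ : ∀ x, ψ x = (η x : ℂ) := fun _ => rfl
  simpa only [hψ, Complex.coe_smul] using h ψ

lemma ae_eq_fourier_fourierInv [NormedSpace ℂ E] [CompleteSpace E] {f : V → E}
    (hf : Integrable f) (hf' : Integrable (𝓕⁻ f)) : f =ᵐ[volume] 𝓕 (𝓕⁻ f) := by
  refine ae_eq_of_integral_schwartz_smul_eq hf.locallyIntegrable
    (continuous_fourier_of_integrable hf').locallyIntegrable fun ψ => ?_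
  calc ∫ x, ψ x • f x = ∫ x, 𝓕⁻ (𝓕 (ψ : V → ℂ)) x • f x := by
        rw [← fourier_coe, ← fourierInv_coe, fourierInv_fourier_eq]
    _ = ∫ x, 𝓕 (ψ : V → ℂ) x • 𝓕⁻ f x :=
        integral_fourierInv_smul_eq (by rw [← fourier_coe]; exact (𝓕 ψ).integrable) hf
    _ = ∫ x, ψ x • 𝓕 (𝓕⁻ f) x := integral_fourier_smul_eq ψ.integrable hf'

section Plancherel

variable [InnerProductSpace ℂ E] [CompleteSpace E] {g : V → E}

lemma coeFn_fourier_toLp (hg : Integrable g) (hg_sq : MemLp g 2) :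
    (𝓕 (hg_sq.toLp g) : Lp E 2 (volume : Measure V)) =ᵐ[volume] 𝓕 g := by
  refine ae_eq_of_integral_schwartz_smul_eq ((Lp.memLp _).locallyIntegrable one_le_two)
    (continuous_fourier_of_integrable hg).locallyIntegrable fun ψ => ?_
  calc ∫ x, ψ x • (𝓕 (hg_sq.toLp g) : Lp E 2 (volume : Measure V)) x
      = ∫ x, (𝓕 ψ) x • hg_sq.toLp g x := by
        rw [← Lp.toTemperedDistribution_apply, ← Lp.toTemperedDistribution_apply,
          ← Lp.fourier_toTemperedDistribution_eq, TemperedDistribution.fourier_apply]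
    _ = ∫ x, 𝓕 (ψ : V → ℂ) x • g x := by
        rw [fourier_coe]
        exact integral_congr_ae (hg_sq.coeFn_toLp.mono fun x hx => by simp only [hx])
    _ = ∫ x, ψ x • 𝓕 g x := integral_fourier_smul_eq ψ.integrable hg

lemma memLp_fourier (hg : Integrable g) (hg_sq : MemLp g 2) : MemLp (𝓕 g) 2 :=
  (memLp_congr_ae (coeFn_fourier_toLp hg hg_sq)).1 (Lp.memLp _)

lemma integral_norm_fourier_sq (hg : Integrable g) (hg_sq : MemLp g 2) :
    ∫ x, ‖𝓕 g x‖ ^ 2 = ∫ x, ‖g x‖ ^ 2 := by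
  let _ : InnerProductSpace ℝ E := .rclikeToReal ℂ E
  calc ∫ x, ‖𝓕 g x‖ ^ 2 = ∫ x, ‖(𝓕 (hg_sq.toLp g) : Lp E 2 (volume : Measure V)) x‖ ^ 2 :=
        integral_congr_ae ((coeFn_fourier_toLp hg hg_sq).mono fun x hx => by simp only [hx])
    _ = ‖𝓕 (hg_sq.toLp g)‖ ^ 2 := (L2_norm_sq_eq_integral _).symm
    _ = ‖hg_sq.toLp g‖ ^ 2 := by rw [Lp.norm_fourier_eq]
    _ = ∫ x, ‖hg_sq.toLp g x‖ ^ 2 := L2_norm_sq_eq_integral _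
    _ = ∫ x, ‖g x‖ ^ 2 :=
        integral_congr_ae (hg_sq.coeFn_toLp.mono fun x hx => by simp only [hx])

end Plancherel

/-- The inversion integral `(2π)⁻ᵈ ∫ exp(-i⟪t, x⟫) φ t dt`, which recovers a density from its
characteristic function `φ`. -/
noncomputable def charInversion (φ : V → ℂ) (x : V) : ℂ :=
  ((2 * Real.pi : ℝ) : ℂ)⁻¹ ^ Module.finrank ℝ V *
    ∫ t, Complex.exp (-Complex.I * (⟪t, x⟫ : ℝ)) * φ t

lemma charInversion_eq_fourier (φ : V → ℂ) (x : V) :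
    charInversion φ x = 𝓕 (fun t => φ ((2 * Real.pi) • t)) x := by
  have hscale := Measure.integral_comp_smul (volume : Measure V)
    (fun t => Complex.exp (-Complex.I * (⟪t, x⟫ : ℝ)) * φ t) (2 * Real.pi)
  rw [abs_of_nonneg (by positivity), Complex.real_smul] at hscale
  rw [Real.fourier_eq', charInversion]
  push_cast [← inv_pow] at hscale ⊢
  rw [← hscale]
  simp only [real_inner_smul_left, smul_eq_mul]
  push_cast
  ring_nf

lemma continuous_charInversion {φ : V → ℂ} (hφ : Integrable φ) : Continuous (charInversion φ) := by
  rw [funext (charInversion_eq_fourier φ)]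
  exact continuous_fourier_of_integrable (hφ.comp_smul (by positivity))

lemma norm_exp_neg_I_mul_ofReal_mul (a : ℝ) (z : ℂ) :
    ‖Complex.exp (-Complex.I * a) * z‖ = ‖z‖ := by
  simp [Complex.norm_exp]

lemma norm_charInversion_le (φ : V → ℂ) (x : V) :
    ‖charInversion φ x‖ ≤ (2 * Real.pi)⁻¹ ^ Module.finrank ℝ V * ∫ t, ‖φ t‖ := by
  rw [charInversion, norm_mul, norm_pow, norm_inv, Complex.norm_of_nonneg (by positivity)]
  gcongr
  exact (norm_integral_le_integral_norm _).trans_eq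
    (by simp only [norm_exp_neg_I_mul_ofReal_mul])

lemma integrable_exp_neg_I_mul_inner_mul {φ : V → ℂ} (hφ : Integrable φ) (x : V) :
    Integrable fun t => Complex.exp (-Complex.I * (⟪t, x⟫ : ℝ)) * φ t :=
  (integrable_norm_iff (by fun_prop)).1 <| by
    simpa only [norm_exp_neg_I_mul_ofReal_mul] using hφ.norm

lemma charInversion_sub {φ ψ : V → ℂ} (hφ : Integrable φ) (hψ : Integrable ψ) (x : V) :
    charInversion (φ - ψ) x = charInversion φ x - charInversion ψ x := by
  simp only [charInversion, Pi.sub_apply, mul_sub]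
  rw [integral_sub (integrable_exp_neg_I_mul_inner_mul hφ x)
    (integrable_exp_neg_I_mul_inner_mul hψ x), mul_sub]

lemma tendstoUniformly_charInversion {ι : Type*} {l : Filter ι} {ψ : ι → V → ℂ} {φ : V → ℂ}
    (hψ : ∀ᶠ i in l, Integrable (ψ i)) (hφ : Integrable φ)
    (h : Tendsto (fun i => ∫ t, ‖ψ i t - φ t‖) l (𝓝 0)) :
    TendstoUniformly (fun i => charInversion (ψ i)) (charInversion φ) l := by
  have hlim := h.const_mul ((2 * Real.pi)⁻¹ ^ Module.finrank ℝ V)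
  rw [mul_zero] at hlim
  rw [Metric.tendstoUniformly_iff]
  intro ε hε
  filter_upwards [hψ, hlim.eventually_lt_const hε] with i hi hlt x
  rw [dist_comm, dist_eq_norm, ← charInversion_sub hi hφ]
  exact (norm_charInversion_le (ψ i - φ) x).trans_lt hlt

lemma ae_eq_charInversion {f φ : V → ℂ} (hf : Integrable f) (hφ : Integrable φ)
    (hfφ : ∀ t, φ t = ∫ x, Complex.exp (Complex.I * (⟪t, x⟫ : ℝ)) * f x) :
    f =ᵐ[volume] charInversion φ := by
  have hφ_inv : (fun t => φ ((2 * Real.pi) • t)) = 𝓕⁻ f := by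
    ext t
    rw [hfφ, Real.fourierInv_eq']
    simp only [real_inner_smul_left, real_inner_comm t, smul_eq_mul]
    push_cast
    ring_nf
  rw [funext (charInversion_eq_fourier φ), hφ_inv]
  exact ae_eq_fourier_fourierInv hf (hφ_inv ▸ hφ.comp_smul (by positivity))

end Fourier

section Characters

variable {V : Type*} [NormedAddCommGroup V] [InnerProductSpace ℝ V] [MeasurableSpace V]
  [BorelSpace V] {ρ : Measure V} [IsFiniteMeasure ρ]

/-- The character `t ↦ exp(i⟪x, t⟫)` as a vector of `L²(ρ)`. -/
noncomputable def charLp (ρ : Measure V) [IsFiniteMeasure ρ] (x : V) : Lp ℂ 2 ρ :=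
  BoundedContinuousFunction.toLp 2 ρ ℂ (BoundedContinuousFunction.innerProbChar x)

lemma coeFn_charLp (x : V) : charLp ρ x =ᵐ[ρ] fun t => Complex.exp (⟪x, t⟫ * Complex.I) :=
  (BoundedContinuousFunction.coeFn_toLp 2 ρ ℂ _).trans
    (ae_of_all _ fun t => by
      rw [BoundedContinuousFunction.innerProbChar_apply, real_inner_comm])

lemma inner_charLp (x y : V) : inner ℂ (charLp ρ x) (charLp ρ y) = charFun ρ (y - x) := by
  rw [charLp, charLp, BoundedContinuousFunction.inner_toLp, charFun_apply]
  congr 1 with t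
  rw [BoundedContinuousFunction.innerProbChar_apply, BoundedContinuousFunction.innerProbChar_apply,
    ← Complex.exp_conj, ← Complex.exp_add]
  simp only [map_mul, Complex.conj_ofReal, Complex.conj_I, inner_sub_right]
  push_cast
  ring_nf

lemma norm_charLp (x : V) : ‖charLp ρ x‖ = √(ρ.real Set.univ) := by
  rw [← Real.sqrt_sq (norm_nonneg _), ← inner_self_eq_norm_sq (𝕜 := ℂ), inner_charLp, sub_self,
    charFun_zero]
  simp

lemma inner_charLp_right (h : Lp ℂ 2 ρ) (x : V) :
    inner ℂ h (charLp ρ x) = ∫ t, Complex.exp (⟪x, t⟫ * Complex.I) * starRingEnd ℂ (h t) ∂ρ := by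
  rw [L2.inner_def]
  refine integral_congr_ae ((coeFn_charLp x).mono fun t ht => ?_)
  simp only [RCLike.inner_apply, ht]

variable [SecondCountableTopology V]

lemma continuous_charLp : Continuous (charLp ρ) := by
  refine continuous_iff_continuousAt.2 fun x => tendsto_iff_norm_sub_tendsto_zero.2 ?_
  have hsq : ∀ y, ‖charLp ρ y - charLp ρ x‖ ^ 2 =
      2 * ρ.real Set.univ - 2 * (charFun ρ (x - y)).re := fun y => by
    rw [norm_sub_sq (𝕜 := ℂ), inner_charLp, norm_charLp, norm_charLp,
      Real.sq_sqrt measureReal_nonneg]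
    simp only [RCLike.re_to_complex]
    ring
  have hcont : Continuous fun y => √(2 * ρ.real Set.univ - 2 * (charFun ρ (x - y)).re) := by
    fun_prop
  have hnorm : (fun y => ‖charLp ρ y - charLp ρ x‖) =
      fun y => √(2 * ρ.real Set.univ - 2 * (charFun ρ (x - y)).re) := by
    ext y
    rw [← hsq, Real.sqrt_sq (norm_nonneg _)]
  rw [hnorm]
  simpa using hcont.tendsto x

lemma integrable_charLp (μ : Measure V) [IsFiniteMeasure μ] : Integrable (charLp ρ) μ :=
  .of_bound continuous_charLp.aestronglyMeasurable _ (ae_of_all _ fun x => (norm_charLp x).le)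

lemma coeFn_integral_charLp (μ : Measure V) [IsFiniteMeasure μ] :
    (∫ x, charLp ρ x ∂μ : Lp ℂ 2 ρ) =ᵐ[ρ] charFun μ := by
  have hφ : Integrable (charFun μ) ρ :=
    .of_bound (by fun_prop) (μ.real Set.univ) (ae_of_all _ norm_charFun_le)
  refine ((Lp.memLp _).integrable one_le_two).ae_eq_of_forall_setIntegral_eq _ _ hφ
    fun s hs hρs => ?_
  have hexp : Integrable (fun p : V × V => Complex.exp (⟪p.1, p.2⟫ * Complex.I))
      (μ.prod (ρ.restrict s)) :=
    .of_bound (by fun_prop) 1 (ae_of_all _ fun p => (Complex.norm_exp_ofReal_mul_I _).le)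
  calc ∫ t in s, (∫ x, charLp ρ x ∂μ : Lp ℂ 2 ρ) t ∂ρ
      = inner ℂ (indicatorConstLp 2 hs hρs.ne 1) (∫ x, charLp ρ x ∂μ) :=
        (L2.inner_indicatorConstLp_one hs hρs.ne _).symm
    _ = ∫ x, ∫ t in s, Complex.exp (⟪x, t⟫ * Complex.I) ∂ρ ∂μ := by
        rw [← integral_inner (integrable_charLp μ)]
        exact integral_congr_ae (ae_of_all _ fun x =>
          (L2.inner_indicatorConstLp_one hs hρs.ne _).trans
            (integral_congr_ae (ae_restrict_of_ae (coeFn_charLp x))))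
    _ = ∫ t in s, charFun μ t ∂ρ := by
        rw [integral_integral_swap hexp]
        rfl

end Characters

section WeakVariance

open FourierTransform

variable {V : Type*} [NormedAddCommGroup V] [InnerProductSpace ℝ V] [FiniteDimensional ℝ V]
  [MeasurableSpace V] [BorelSpace V] {μ : Measure V} {C : NNReal}

lemma integral_norm_integral_exp_sq_le (hμ : μ ≤ C • (volume : Measure V)) {g : V → ℂ}
    (hg : Integrable g) (hg_sq : MemLp g 2) :
    ∫ x, ‖∫ t, Complex.exp (⟪x, t⟫ * Complex.I) * g t‖ ^ 2 ∂μ ≤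
      C * (2 * Real.pi) ^ Module.finrank ℝ V * ∫ t, ‖g t‖ ^ 2 := by
  have hfourier : ∀ x, ∫ t, Complex.exp (⟪x, t⟫ * Complex.I) * g t =
      𝓕 g (-(2 * Real.pi)⁻¹ • x) := fun x => by
    rw [Real.fourier_eq']
    congr 1 with t
    rw [real_inner_smul_right, real_inner_comm x t, smul_eq_mul]
    congr 2
    push_cast
    field_simp
  have hint : Integrable (fun x => ‖𝓕 g (-(2 * Real.pi)⁻¹ • x)‖ ^ 2) :=
    ((memLp_fourier hg hg_sq).integrable_norm_pow two_ne_zero).comp_smul (by simp [Real.pi_ne_zero])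
  simp only [hfourier]
  calc ∫ x, ‖𝓕 g (-(2 * Real.pi)⁻¹ • x)‖ ^ 2 ∂μ
      ≤ ∫ x, ‖𝓕 g (-(2 * Real.pi)⁻¹ • x)‖ ^ 2 ∂(C • volume) :=
        integral_mono_measure hμ (ae_of_all _ fun x => by positivity) (hint.smul_measure_nnreal)
    _ = C * ∫ x, ‖𝓕 g (-(2 * Real.pi)⁻¹ • x)‖ ^ 2 := integral_smul_nnreal_measure _ _
    _ = C * (2 * Real.pi) ^ Module.finrank ℝ V * ∫ x, ‖𝓕 g x‖ ^ 2 := by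
        rw [Measure.integral_comp_smul volume (fun x => ‖𝓕 g x‖ ^ 2), smul_eq_mul]
        rw [abs_inv, abs_pow, abs_neg, abs_inv, abs_of_pos Real.two_pi_pos, inv_pow, inv_inv,
          mul_assoc]
    _ = _ := by rw [integral_norm_fourier_sq hg hg_sq]

lemma integral_inner_charLp_sq_le [IsFiniteMeasure μ] (hμ : μ ≤ C • (volume : Measure V))
    {D : Set V} (hD : MeasurableSet D) [IsFiniteMeasure (volume.restrict D)]
    (h : Lp ℂ 2 (volume.restrict D)) :
    ∫ x, ⟪h, charLp (volume.restrict D) x⟫ ^ 2 ∂μ ≤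
      C * (2 * Real.pi) ^ Module.finrank ℝ V * ‖h‖ ^ 2 := by
  let g : V → ℂ := D.indicator fun t => starRingEnd ℂ (h t)
  have hconj : MemLp (fun t => starRingEnd ℂ (h t)) 2 (volume.restrict D) := (Lp.memLp h).star
  have hg_sq : MemLp g 2 := (memLp_indicator_iff_restrict hD).2 hconj
  have hg : Integrable g := (integrable_indicator_iff hD).2 (hconj.integrable one_le_two)
  have hinner : ∀ x, inner ℂ h (charLp (volume.restrict D) x) =
      ∫ t, Complex.exp (⟪x, t⟫ * Complex.I) * g t := fun x => by
    rw [inner_charLp_right, ← integral_indicator hD]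
    simp only [g, Set.indicator_mul_right]
  have hmem : MemLp (charLp (volume.restrict D)) 2 μ :=
    .of_bound continuous_charLp.aestronglyMeasurable _ (ae_of_all _ fun x => (norm_charLp x).le)
  have hg_norm : ∫ t, ‖g t‖ ^ 2 = ‖h‖ ^ 2 := by
    rw [L2_norm_sq_eq_integral, ← integral_indicator hD]
    congr 1 with t
    by_cases ht : t ∈ D <;> simp [g, ht]
  calc ∫ x, ⟪h, charLp (volume.restrict D) x⟫ ^ 2 ∂μ
      ≤ ∫ x, ‖inner ℂ h (charLp (volume.restrict D) x)‖ ^ 2 ∂μ := by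
        refine integral_mono_of_nonneg (ae_of_all _ fun x => sq_nonneg _) ?_
          (ae_of_all _ fun x => sq_le_sq.2 ?_)
        · exact (hmem.const_inner h).integrable_norm_pow two_ne_zero
        · exact (abs_real_inner_le_norm_inner h _).trans (le_abs_self _)
    _ ≤ C * (2 * Real.pi) ^ Module.finrank ℝ V * ‖h‖ ^ 2 := by
        simpa only [hinner, hg_norm] using integral_norm_integral_exp_sq_le hμ hg hg_sq

end WeakVariance

section EmpiricalCharFun

variable {V : Type*} [NormedAddCommGroup V] [InnerProductSpace ℝ V]

/-- The empirical characteristic function of the sample points `x 0, …, x (n - 1)`. -/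
noncomputable def empiricalCharFun (x : ℕ → V) (n : ℕ) (t : V) : ℂ :=
  (n : ℂ)⁻¹ * ∑ j ∈ Finset.range n, Complex.exp (⟪x j, t⟫ * Complex.I)

lemma norm_empiricalCharFun_le_one (x : ℕ → V) (n : ℕ) (t : V) : ‖empiricalCharFun x n t‖ ≤ 1 := by
  rw [empiricalCharFun, norm_mul, norm_inv, Complex.norm_natCast, inv_mul_eq_div]
  refine div_le_one_of_le₀ ((norm_sum_le _ _).trans_eq ?_) n.cast_nonneg
  simp only [Complex.norm_exp_ofReal_mul_I, Finset.sum_const, Finset.card_range, nsmul_one]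

@[fun_prop]
lemma continuous_empiricalCharFun (x : ℕ → V) (n : ℕ) : Continuous (empiricalCharFun x n) := by
  unfold empiricalCharFun
  fun_prop

variable [MeasurableSpace V] [BorelSpace V]

lemma integral_norm_empiricalCharFun_sub_charFun_le [SecondCountableTopology V] {ρ : Measure V}
    [IsFiniteMeasure ρ] (μ : Measure V) [IsFiniteMeasure μ] (x : ℕ → V) {n : ℕ} (hn : n ≠ 0) :
    n * ∫ t, ‖empiricalCharFun x n t - charFun μ t‖ ∂ρ ≤
      √(ρ.real Set.univ) * ‖∑ j ∈ Finset.range n, (charLp ρ (x j) - ∫ y, charLp ρ y ∂μ)‖ := by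
  set S : Lp ℂ 2 ρ := ∑ j ∈ Finset.range n, (charLp ρ (x j) - ∫ y, charLp ρ y ∂μ)
  have hS : ∀ᵐ t ∂ρ, ‖S t‖ = n * ‖empiricalCharFun x n t - charFun μ t‖ := by
    filter_upwards [Lp.coeFn_fun_finsetSum (Finset.range n) fun j =>
        charLp ρ (x j) - ∫ y, charLp ρ y ∂μ,
      ae_all_iff.2 fun j => Lp.coeFn_sub (charLp ρ (x j)) (∫ y, charLp ρ y ∂μ),
      ae_all_iff.2 fun j => coeFn_charLp (ρ := ρ) (x j), coeFn_integral_charLp (ρ := ρ) μ]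
      with t hsum hsub hchar hmean
    have hn' : (n : ℂ) ≠ 0 := mod_cast hn
    rw [hsum, ← Complex.norm_natCast n, ← norm_mul, empiricalCharFun, mul_sub,
      mul_inv_cancel_left₀ hn']
    simp only [hsub, Pi.sub_apply, hchar, hmean, Finset.sum_sub_distrib, Finset.sum_const,
      Finset.card_range, nsmul_eq_mul]
  rw [← integral_const_mul, ← integral_congr_ae hS]
  exact integral_norm_le_sqrt_mul_norm S

variable {Ω : Type*} [MeasurableSpace Ω] {P : Measure Ω} [IsProbabilityMeasure P]

variable [FiniteDimensional ℝ V] {μ : Measure V} {C : NNReal}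

lemma isCenteredBounded_charLp (hμ : μ ≤ C • (volume : Measure V)) {D : Set V}
    (hD : MeasurableSet D) [IsFiniteMeasure (volume.restrict D)] {Y : Ω → V} (hY : Measurable Y)
    (hY_law : P.map Y = μ) :
    IsCenteredBounded
      (fun ω => charLp (volume.restrict D) (Y ω) - ∫ x, charLp (volume.restrict D) x ∂μ) P
      (2 * √(volume.real D)) (C * (2 * Real.pi) ^ Module.finrank ℝ V) := by
  have : IsFiniteMeasure μ := hY_law ▸ inferInstance
  have hmeas : AEStronglyMeasurable (charLp (volume.restrict D)) (P.map Y) :=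
    continuous_charLp.aestronglyMeasurable
  rw [← hY_law, integral_map hY.aemeasurable hmeas]
  refine isCenteredBounded_sub_integral (hmeas.comp_measurable hY) (fun ω => ?_) fun h => ?_
  · rw [norm_charLp, measureReal_restrict_apply_univ]
  · have hinner : Continuous fun x => ⟪h, charLp (volume.restrict D) x⟫ ^ 2 :=
      (continuous_const.inner continuous_charLp).pow 2
    rw [← integral_map hY.aemeasurable hinner.aestronglyMeasurable, hY_law]
    exact integral_inner_charLp_sq_le hμ hD h

variable {X : ℕ → Ω → V}

lemma measureReal_le_norm_sum_charLp_sub_le_exp (hX : ∀ j, Measurable (X j))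
    (hX_indep : iIndepFun X P) (hX_law : ∀ j, P.map (X j) = μ) (hμ : μ ≤ C • (volume : Measure V))
    {D : Set V} (hD : MeasurableSet D) [IsFiniteMeasure (volume.restrict D)] {W ε c : ℝ}
    (hW : 0 < W) (hDW : volume.real D ≤ W) (hε : 0 < ε) (hc : 0 ≤ c) (hc_half : c ≤ 1 / 2)
    (hcv : 4 * c * (C * (2 * Real.pi) ^ Module.finrank ℝ V) ≤ ε) {n : ℕ} (hn : n ≠ 0)
    (hWn : 32 * W ^ 2 ≤ ε ^ 2 * n) :
    P.real {ω | n * ε / √W ≤ ‖∑ j ∈ Finset.range n,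
        (charLp (volume.restrict D) (X j ω) - ∫ x, charLp (volume.restrict D) x ∂μ)‖} ≤
      Real.exp (-(c * ε * n / (4 * W))) := by
  let _ : MeasurableSpace (Lp ℂ 2 (volume.restrict D)) := borel _
  have : BorelSpace (Lp ℂ 2 (volume.restrict D)) := ⟨rfl⟩
  have : Fact ((2 : ℝ≥0∞) ≠ ∞) := ⟨ENNReal.ofNat_ne_top⟩
  let ξ : V → Lp ℂ 2 (volume.restrict D) := fun x =>
    charLp (volume.restrict D) x - ∫ y, charLp (volume.restrict D) y ∂μ
  have hξ : Measurable ξ := (continuous_charLp.sub continuous_const).measurable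
  have hsqW : √W ^ 2 = W := Real.sq_sqrt hW.le
  have hsqD : √(volume.real D) ^ 2 ≤ W := by rwa [Real.sq_sqrt measureReal_nonneg]
  have hrange : c / √W * (2 * √(volume.real D)) ≤ 1 := by
    calc c / √W * (2 * √(volume.real D)) ≤ 1 / 2 / √W * (2 * √W) := by gcongr
      _ = 1 := by field_simp
  have hrange_sq : 8 * n * (2 * √(volume.real D)) ^ 2 ≤ (n * ε / √W) ^ 2 := by
    rw [div_pow, hsqW, le_div_iff₀ hW, mul_pow]
    calc 8 * n * (2 ^ 2 * √(volume.real D) ^ 2) * W ≤ 8 * n * (2 ^ 2 * W) * W := by gcongr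
      _ = n * (32 * W ^ 2) := by ring
      _ ≤ n * (ε ^ 2 * n) := by gcongr
      _ = (n * ε) ^ 2 := by ring
  have hvariance :
      4 * n * (c / √W) * (C * (2 * Real.pi) ^ Module.finrank ℝ V) ≤ n * ε / √W := by
    calc 4 * n * (c / √W) * (C * (2 * Real.pi) ^ Module.finrank ℝ V)
        = n * (4 * c * (C * (2 * Real.pi) ^ Module.finrank ℝ V)) / √W := by ring
      _ ≤ n * ε / √W := by gcongr
  refine (measureReal_le_norm_sum_le_exp (fun j => hξ.comp (hX j))
    (hX_indep.comp (fun _ => ξ) fun _ => hξ)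
    (fun j => isCenteredBounded_charLp hμ hD (hX j) (hX_law j)) (by positivity) (by positivity)
    hrange (by positivity) hrange_sq hvariance).trans_eq ?_
  rw [div_mul_div_comm, ← sq, hsqW]
  field_simp

lemma measureReal_le_integral_norm_empiricalCharFun_sub_le_exp (hX : ∀ j, Measurable (X j))
    (hX_indep : iIndepFun X P) (hX_law : ∀ j, P.map (X j) = μ) (hμ : μ ≤ C • (volume : Measure V))
    {D : Set V} (hD : MeasurableSet D) {W ε c : ℝ} (hW : 0 < W)
    (hDW : volume D ≤ ENNReal.ofReal W) (hε : 0 < ε) (hc : 0 ≤ c) (hc_half : c ≤ 1 / 2)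
    (hcv : 4 * c * (C * (2 * Real.pi) ^ Module.finrank ℝ V) ≤ ε) {n : ℕ} (hn : n ≠ 0)
    (hWn : 32 * W ^ 2 ≤ ε ^ 2 * n) :
    P.real {ω | ε ≤ ∫ t in D, ‖empiricalCharFun (fun j => X j ω) n t - charFun μ t‖} ≤
      Real.exp (-(c * ε * n / (4 * W))) := by
  have : IsFiniteMeasure (volume.restrict D) :=
    ⟨by simpa using hDW.trans_lt ENNReal.ofReal_lt_top⟩
  have : IsFiniteMeasure μ := hX_law 0 ▸ inferInstance
  have hD_le : volume.real D ≤ W := ENNReal.toReal_le_of_le_ofReal hW.le hDW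
  refine (measureReal_mono fun ω hω => ?_).trans
    (measureReal_le_norm_sum_charLp_sub_le_exp hX hX_indep hX_law hμ hD hW hD_le hε hc hc_half hcv
      hn hWn)
  have hnorm := integral_norm_empiricalCharFun_sub_charFun_le (ρ := volume.restrict D) μ
    (fun j => X j ω) hn
  rw [measureReal_restrict_apply_univ] at hnorm
  rw [Set.mem_ofPred_eq, div_le_iff₀' (Real.sqrt_pos.2 hW)]
  calc n * ε ≤ n * ∫ t in D, ‖empiricalCharFun (fun j => X j ω) n t - charFun μ t‖ := by
        gcongr
        exact hω
    _ ≤ √(volume.real D) * ‖_‖ := hnorm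
    _ ≤ √W * ‖_‖ := by gcongr

end EmpiricalCharFun

section AlmostSureConvergence

variable {Ω : Type*} [MeasurableSpace Ω] {P : Measure Ω} [IsFiniteMeasure P]

lemma ae_tendsto_zero_of_summable_measureReal {E : Type*} [SeminormedAddCommGroup E]
    {Y : ℕ → Ω → E} (hY : ∀ ε > 0, Summable fun n => P.real {ω | ε ≤ ‖Y n ω‖}) :
    ∀ᵐ ω ∂P, Tendsto (fun n => Y n ω) atTop (𝓝 0) := by
  have hev : ∀ᵐ ω ∂P, ∀ k : ℕ, ∀ᶠ n in atTop, ‖Y n ω‖ < 1 / ((k : ℝ) + 1) := by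
    refine ae_all_iff.2 fun k => ?_
    have hsum := (hY (1 / ((k : ℝ) + 1)) (by positivity)).tsum_ofReal_ne_top
    simp only [ofReal_measureReal (measure_ne_top P _)] at hsum
    simpa only [Set.mem_ofPred_eq, not_le] using ae_eventually_notMem hsum
  filter_upwards [hev] with ω hω
  refine NormedAddGroup.tendsto_nhds_zero.2 fun ε hε => ?_
  obtain ⟨k, hk⟩ := exists_nat_one_div_lt hε
  exact (hω k).mono fun n hn => hn.trans hk

lemma summable_exp_neg_mul_sqrt {k : ℝ} (hk : 0 < k) :
    Summable fun n : ℕ => Real.exp (-(k * √n)) := by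
  have hsqrt : Tendsto (fun n : ℕ => √(n : ℝ)) atTop atTop :=
    Real.tendsto_sqrt_atTop.comp tendsto_natCast_atTop_atTop
  refine summable_of_isBigO_nat (Real.summable_nat_rpow.2 (show (-2 : ℝ) < -1 by norm_num)) ?_
  refine (((isLittleO_exp_neg_mul_rpow_atTop hk (-4)).comp_tendsto hsqrt).isBigO.congr ?_ ?_)
  · intro n
    simp only [Function.comp_apply, neg_mul]
  · intro n
    simp only [Function.comp_apply, Real.sqrt_eq_rpow, ← Real.rpow_mul n.cast_nonneg]
    norm_num

end AlmostSureConvergence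

section EmpiricalCharFunConvergence

variable {V : Type*} [NormedAddCommGroup V] [InnerProductSpace ℝ V] [FiniteDimensional ℝ V]
  [MeasurableSpace V] [BorelSpace V] {μ : Measure V} {C : NNReal}
  {Ω : Type*} [MeasurableSpace Ω] {P : Measure Ω} [IsProbabilityMeasure P] {X : ℕ → Ω → V}

lemma ae_tendsto_integral_norm_empiricalCharFun_sub (hX : ∀ j, Measurable (X j))
    (hX_indep : iIndepFun X P) (hX_law : ∀ j, P.map (X j) = μ)
    (hμ : μ ≤ C • (volume : Measure V)) {D : ℕ → Set V} (hD : ∀ n, MeasurableSet (D n))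
    (hD_vol : Tendsto (fun n : ℕ => volume (D n) / ENNReal.ofReal √n) atTop (𝓝 0)) :
    ∀ᵐ ω ∂P, Tendsto
      (fun n => ∫ t in D n, ‖empiricalCharFun (fun j => X j ω) n t - charFun μ t‖)
      atTop (𝓝 0) := by
  refine ae_tendsto_zero_of_summable_measureReal fun ε hε => ?_
  let v : ℝ := C * (2 * Real.pi) ^ Module.finrank ℝ V
  have hv : 0 ≤ v := by positivity
  obtain ⟨c, hc, hc_half, hcv⟩ : ∃ c : ℝ, 0 < c ∧ c ≤ 1 / 2 ∧ 4 * c * v ≤ ε := by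
    refine ⟨min (1 / 2) (ε / (4 * (v + 1))), by positivity, min_le_left _ _, ?_⟩
    calc 4 * min (1 / 2) (ε / (4 * (v + 1))) * v ≤ 4 * (ε / (4 * (v + 1))) * (v + 1) := by
          gcongr
          · exact min_le_right _ _
          · linarith
      _ = ε := by field_simp
  have hsum := summable_exp_neg_mul_sqrt (show 0 < 3 / 2 * c by positivity)
  refine hsum.of_norm_bounded_eventually_nat ?_
  filter_upwards [hD_vol.eventually_le_const (ENNReal.ofReal_pos.2 (show 0 < ε / 6 by positivity)),
    eventually_gt_atTop 0] with n hDn hn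
  have hsq : √(n : ℝ) ^ 2 = n := Real.sq_sqrt n.cast_nonneg
  have hpos : 0 < √(n : ℝ) := Real.sqrt_pos.2 (mod_cast hn)
  rw [ENNReal.div_le_iff (by simpa using hn) ENNReal.ofReal_ne_top,
    ← ENNReal.ofReal_mul (by positivity)] at hDn
  simp only [Real.norm_of_nonneg measureReal_nonneg,
    Real.norm_of_nonneg (integral_nonneg fun _ => norm_nonneg _)]
  refine (measureReal_le_integral_norm_empiricalCharFun_sub_le_exp hX hX_indep hX_law hμ (hD n)
    (by positivity) hDn hε hc.le hc_half hcv hn.ne' ?_).trans_eq ?_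
  · rw [mul_pow, hsq]
    nlinarith [sq_nonneg ε, mul_nonneg (sq_nonneg ε) n.cast_nonneg]
  · rw [show c * ε * n / (4 * (ε / 6 * √n)) = 3 / 2 * c * (n / √n) by field_simp; norm_num,
      Real.div_sqrt]

end EmpiricalCharFunConvergence

section Density

lemma eqOn_support_of_ae_eq {Z Y : Type*} [TopologicalSpace Z] [HereditarilyLindelofSpace Z]
    [MeasurableSpace Z] [TopologicalSpace Y] [T2Space Y] {μ : Measure Z} {g h : Z → Y}
    (hgh : g =ᵐ[μ] h) (hg : ContinuousOn g μ.support) (hh : ContinuousOn h μ.support) :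
    Set.EqOn g h μ.support :=
  Set.EqOn.of_subset_closure (s := μ.support ∩ {z | g z = h z}) (fun _ hz => hz.2) hg hh
    Set.inter_subset_left <| Measure.support_subset_of_isClosed isClosed_closure <|
      mem_of_superset (inter_mem Measure.support_mem_ae hgh) subset_closure

variable {f : Plane → ℝ}

lemma densityFourier_eq_charFun (hf_meas : Measurable f) (hf_nonneg : ∀ x, 0 ≤ f x) :
    densityFourier f = charFun (densityLaw f) := by
  ext t
  rw [charFun_apply, densityLaw, integral_withDensity_eq_integral_toReal_smul
    hf_meas.ennreal_ofReal (ae_of_all _ fun x => ENNReal.ofReal_lt_top), densityFourier]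
  simp only [ENNReal.toReal_ofReal (hf_nonneg _), Complex.real_smul, real_inner_comm t,
    mul_comm Complex.I, mul_comm (Complex.exp _)]

lemma integrable_of_isFiniteMeasure_densityLaw (hf_meas : Measurable f)
    (hf_nonneg : ∀ x, 0 ≤ f x) [IsFiniteMeasure (densityLaw f)] : Integrable f := by
  rw [← lintegral_ofReal_ne_top_iff_integrable hf_meas.aestronglyMeasurable
    (ae_of_all _ hf_nonneg), ← setLIntegral_univ, ← withDensity_apply _ MeasurableSet.univ]
  exact measure_ne_top (densityLaw f) Set.univ

lemma ae_eq_charInversion_densityFourier (hf : Integrable f)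
    (hφ : Integrable (densityFourier f)) :
    (fun x => (f x : ℂ)) =ᵐ[volume] charInversion (densityFourier f) :=
  ae_eq_charInversion hf.ofReal hφ fun _ => rfl

lemma exists_densityLaw_le_smul_volume (hf : Integrable f) (hφ : Integrable (densityFourier f)) :
    ∃ C : NNReal, densityLaw f ≤ C • (volume : Measure Plane) := by
  refine ⟨Real.toNNReal ((2 * Real.pi)⁻¹ ^ Module.finrank ℝ Plane * ∫ t, ‖densityFourier f t‖), ?_⟩
  refine (withDensity_mono ?_).trans_eq (withDensity_const (ENNReal.ofReal _))
  filter_upwards [ae_eq_charInversion_densityFourier hf hφ] with x hx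
  refine ENNReal.ofReal_le_ofReal ?_
  calc f x ≤ ‖(f x : ℂ)‖ := (le_abs_self _).trans_eq (Complex.norm_real _).symm
    _ = ‖charInversion (densityFourier f) x‖ := by rw [hx]
    _ ≤ _ := norm_charInversion_le _ x

lemma eqOn_charInversion_densitySupport (hf : Integrable f)
    (hφ : Integrable (densityFourier f)) (hfc : ContinuousOn f (densitySupport f)) :
    Set.EqOn (charInversion (densityFourier f)) (fun x => (f x : ℂ)) (densitySupport f) :=
  eqOn_support_of_ae_eq
    ((withDensity_absolutelyContinuous _ _).ae_eq (ae_eq_charInversion_densityFourier hf hφ).symm)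
    (continuous_charInversion hφ).continuousOn (Complex.continuous_ofReal.comp_continuousOn hfc)

lemma charInversion_densityFourier_eq (hf : Integrable f) (hφ : Integrable (densityFourier f))
    (hfc : ContinuousOn f (densitySupport f)) (hf0 : ∀ x ∉ densitySupport f, f x = 0) :
    charInversion (densityFourier f) = fun x => (f x : ℂ) := by
  have hopen : IsOpen (densitySupport f)ᶜ := Measure.isOpen_compl_support
  have hf0' : Set.EqOn (fun x => (f x : ℂ)) 0 (densitySupport f)ᶜ := fun x hx => by
    simp [hf0 x hx]
  have hoff := Measure.eqOn_open_of_ae_eq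
    (ae_restrict_of_ae (ae_eq_charInversion_densityFourier hf hφ).symm) hopen
    (continuous_charInversion hφ).continuousOn (continuousOn_const.congr hf0')
  funext x
  by_cases hx : x ∈ densitySupport f
  · exact eqOn_charInversion_densitySupport hf hφ hfc hx
  · exact hoff hx

end Density

section IntegralEstimates

variable {α E : Type*} [MeasurableSpace α] {μ : Measure α} [NormedAddCommGroup E]

lemma integral_norm_sub_le_of_eqOn_compl_zero {F g φ : α → E} {A D : Set α} {b : ℝ}
    (hA : MeasurableSet A) (hAD : A ⊆ D) (hμD : μ D ≠ ∞)
    (hF : Integrable F μ) (hg : IntegrableOn g D μ) (hφ : Integrable φ μ) (hb : 0 ≤ b)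
    (hFg : ∀ t ∈ A, ‖F t - g t‖ ≤ b) (hF0 : Set.EqOn F 0 Aᶜ) :
    ∫ t, ‖F t - φ t‖ ∂μ ≤
      ∫ t in D, ‖g t - φ t‖ ∂μ + μ.real D * b + ∫ t in Aᶜ, ‖φ t‖ ∂μ := by
  have hgφ : IntegrableOn (fun t => ‖g t - φ t‖) D μ := (hg.sub hφ.integrableOn).norm
  have hbD : IntegrableOn (fun _ => b) D μ := integrableOn_const hμD
  have hFφ : Integrable (fun t => ‖F t - φ t‖) μ := (hF.sub hφ).norm
  have hcompl : ∫ t in Aᶜ, ‖F t - φ t‖ ∂μ = ∫ t in Aᶜ, ‖φ t‖ ∂μ :=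
    setIntegral_congr_fun hA.compl fun t ht => by
      simp only [hF0 ht, Pi.zero_apply, zero_sub, norm_neg]
  rw [← integral_add_compl hA hFφ, hcompl]
  gcongr
  calc ∫ t in A, ‖F t - φ t‖ ∂μ ≤ ∫ t in A, (‖g t - φ t‖ + b) ∂μ := by
        refine setIntegral_mono_on hFφ.integrableOn
          ((hgφ.add hbD).mono_set hAD) hA fun t ht => ?_
        linarith [hFg t ht, norm_sub_le_norm_sub_add_norm_sub (F t) (g t) (φ t)]
    _ ≤ ∫ t in D, (‖g t - φ t‖ + b) ∂μ :=
        setIntegral_mono_set (hgφ.add hbD) (ae_of_all _ fun t => by positivity) hAD.eventuallyLE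
    _ = ∫ t in D, ‖g t - φ t‖ ∂μ + μ.real D * b := by
        rw [integral_add hgφ hbD, setIntegral_const, smul_eq_mul]

lemma tendsto_setIntegral_norm_of_tendsto_measure_inter_ball [PseudoMetricSpace α]
    [OpensMeasurableSpace α] {ι : Type*} {l : Filter ι} {g : α → E} (hg : Integrable g μ)
    {s : ι → Set α} (c : α)
    (hs : ∀ r : ℝ, Tendsto (fun i => μ (s i ∩ Metric.ball c r)) l (𝓝 0)) :
    Tendsto (fun i => ∫ t in s i, ‖g t‖ ∂μ) l (𝓝 0) := by
  have htail : Tendsto (fun k : ℕ => ∫ t in (Metric.ball c k)ᶜ, ‖g t‖ ∂μ) atTop (𝓝 0) := by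
    have h := tendsto_setIntegral_of_antitone (s := fun k : ℕ => (Metric.ball c k)ᶜ)
      (fun k => measurableSet_ball.compl)
      (fun i j hij => Set.compl_subset_compl.2 (Metric.ball_subset_ball (mod_cast hij)))
      ⟨0, hg.norm.integrableOn⟩
    rwa [← Set.compl_iUnion, Metric.iUnion_ball_nat, Set.compl_univ, setIntegral_empty] at h
  refine tendsto_order.2 ⟨fun a ha => Eventually.of_forall fun i =>
    ha.trans_le (integral_nonneg fun t => norm_nonneg _), fun ε hε => ?_⟩
  obtain ⟨k, hk⟩ := (htail.eventually_lt_const (half_pos hε)).exists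
  filter_upwards [(hg.norm.tendsto_setIntegral_nhds_zero (hs k)).eventually_lt_const
    (half_pos hε)] with i hi
  have hfar : ∫ t in s i \ Metric.ball c k, ‖g t‖ ∂μ ≤ ∫ t in (Metric.ball c k)ᶜ, ‖g t‖ ∂μ :=
    setIntegral_mono_set hg.norm.integrableOn (ae_of_all _ fun t => norm_nonneg _)
      (LE.le.eventuallyLE fun t ht => ht.2)
  rw [← integral_inter_add_sdiff measurableSet_ball hg.norm.integrableOn]
  linarith

end IntegralEstimates

section OptimalFactor

/-- The factor by which the optimal transform kernel multiplies a value of modulus `z` of the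
empirical characteristic function of `n` points. -/
noncomputable def optimalFactor (n : ℕ) (z : ℝ) : ℝ :=
  (n : ℝ) / (2 * ((n : ℝ) - 1)) * (1 + √(1 - 4 * ((n : ℝ) - 1) / (n * z) ^ 2))

lemma measurable_optimalFactor (n : ℕ) : Measurable (optimalFactor n) := by
  unfold optimalFactor
  fun_prop

lemma abs_optimalFactor_le {n : ℕ} (hn : 2 ≤ n) (z : ℝ) :
    |optimalFactor n z| ≤ n / ((n : ℝ) - 1) := by
  have hm : 0 < (n : ℝ) - 1 := sub_pos.2 (mod_cast hn)
  have hroot : √(1 - 4 * ((n : ℝ) - 1) / (n * z) ^ 2) ≤ 1 :=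
    Real.sqrt_le_one.2 (sub_le_self _ (by positivity))
  rw [optimalFactor, abs_of_nonneg (by positivity)]
  calc _ ≤ (n : ℝ) / (2 * ((n : ℝ) - 1)) * (1 + 1) := by gcongr
    _ = n / ((n : ℝ) - 1) := by field_simp; norm_num

lemma one_sub_sqrt_one_sub_le_sqrt {y : ℝ} (hy : 0 ≤ y) : 1 - √(1 - y) ≤ √y := by
  rcases le_total (√y) 1 with h | h
  · have hsq : (1 - √y) ^ 2 ≤ 1 - y := by nlinarith [Real.sq_sqrt hy, Real.sqrt_nonneg y]
    linarith [Real.le_sqrt_of_sq_le hsq]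
  · linarith [Real.sqrt_nonneg (1 - y)]

lemma abs_optimalFactor_sub_one_mul_le {n : ℕ} (hn : 2 ≤ n) {z : ℝ} (hz : 0 ≤ z) (hz1 : z ≤ 1) :
    |optimalFactor n z - 1| * z ≤ 1 / ((n : ℝ) - 1) + 1 / √((n : ℝ) - 1) := by
  have hm : 0 < (n : ℝ) - 1 := sub_pos.2 (mod_cast hn)
  rcases hz.eq_or_lt with rfl | hz_pos
  · rw [mul_zero]
    positivity
  have hn0 : 0 < (n : ℝ) := by linarith
  rw [optimalFactor]
  set m := (n : ℝ) - 1
  set s := √(1 - 4 * m / (n * z) ^ 2)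
  have hs : 1 - s ≤ 2 * √m / (n * z) := by
    refine (one_sub_sqrt_one_sub_le_sqrt (by positivity)).trans_eq ?_
    rw [Real.sqrt_div (by positivity), Real.sqrt_sq (by positivity), Real.sqrt_mul (by norm_num),
      show (4 : ℝ) = 2 ^ 2 by norm_num, Real.sqrt_sq (by norm_num)]
  have hs1 : 0 ≤ 1 - s := sub_nonneg.2 (Real.sqrt_le_one.2 (sub_le_self _ (by positivity)))
  have hroot : n / (2 * m) * (1 - s) * z ≤ 1 / √m := by
    calc n / (2 * m) * (1 - s) * z ≤ n / (2 * m) * (2 * √m / (n * z)) * z := by gcongr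
      _ = √m / m := by field_simp [hn0.ne']
      _ = 1 / √m := Real.sqrt_div_self'
  have hroot0 : 0 ≤ n / (2 * m) * (1 - s) * z := by positivity
  have hmain : 1 / m * z ≤ 1 / m := mul_le_of_le_one_right (by positivity) hz1
  have hmain0 : 0 ≤ 1 / m * z := by positivity
  have hsplit : (n / (2 * m) * (1 + s) - 1) * z = 1 / m * z - n / (2 * m) * (1 - s) * z := by
    rw [show (n : ℝ) = m + 1 by ring]
    field_simp
    ring
  rw [← abs_of_nonneg hz, ← abs_mul, hsplit, abs_le]
  constructor <;> linarith

lemma abs_optimalFactor_sub_one_mul_le_four_div_sqrt {n : ℕ} (hn : 2 ≤ n) {z : ℝ} (hz : 0 ≤ z)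
    (hz1 : z ≤ 1) : |optimalFactor n z - 1| * z ≤ 4 / √n := by
  have hn' : (2 : ℝ) ≤ n := mod_cast hn
  have hm : 1 ≤ (n : ℝ) - 1 := by linarith
  have hsqrt_n : 0 < √(n : ℝ) := Real.sqrt_pos.2 (by linarith)
  have hsqrt_m : √n / 2 ≤ √((n : ℝ) - 1) :=
    Real.le_sqrt_of_sq_le (by rw [div_pow, Real.sq_sqrt (by linarith)]; linarith)
  have hm_le : √((n : ℝ) - 1) ≤ (n : ℝ) - 1 :=
    Real.sqrt_le_self_iff.2 (Or.inr hm)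
  calc |optimalFactor n z - 1| * z ≤ 1 / ((n : ℝ) - 1) + 1 / √((n : ℝ) - 1) :=
        abs_optimalFactor_sub_one_mul_le hn hz hz1
    _ ≤ 1 / (√n / 2) + 1 / (√n / 2) :=
        add_le_add (one_div_le_one_div_of_le (half_pos hsqrt_n) (hsqrt_m.trans hm_le))
          (one_div_le_one_div_of_le (half_pos hsqrt_n) hsqrt_m)
    _ = 4 / √n := by field_simp; norm_num

end OptimalFactor

lemma inv_mul_sum_charInversion_sub {V : Type*} [NormedAddCommGroup V] [InnerProductSpace ℝ V]
    [FiniteDimensional ℝ V] [MeasurableSpace V] [BorelSpace V] {κ : V → ℂ} (hκ : Integrable κ)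
    (x : ℕ → V) (n : ℕ) (y : V) :
    (n : ℂ)⁻¹ * ∑ j ∈ Finset.range n, charInversion κ (y - x j) =
      charInversion (fun t => κ t * empiricalCharFun x n t) y := by
  simp only [charInversion]
  rw [← Finset.mul_sum,
    ← integral_finsetSum _ fun j _ => integrable_exp_neg_I_mul_inner_mul hκ (y - x j),
    mul_left_comm, ← integral_const_mul]
  congr 2 with t
  have hexp (j : ℕ) : Complex.exp (-Complex.I * (⟪t, y - x j⟫ : ℝ)) =
      Complex.exp (-Complex.I * (⟪t, y⟫ : ℝ)) * Complex.exp (⟪x j, t⟫ * Complex.I) := by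
    rw [← Complex.exp_add, inner_sub_right, real_inner_comm t (x j)]
    push_cast
    ring_nf
  simp only [hexp, empiricalCharFun, Finset.mul_sum]
  exact Finset.sum_congr rfl fun j _ => by ring

section SelfConsistentEstimator

variable {X : ℕ → Plane} {A : Set Plane} {n : ℕ}

lemma ecf_eq_empiricalCharFun (X : ℕ → Plane) : ecf X = empiricalCharFun X := by
  ext n t
  simp only [ecf, empiricalCharFun, real_inner_comm t, mul_comm Complex.I]

lemma sceTransformKernel_eq_indicator (X : ℕ → Plane) (A : Set Plane) (n : ℕ) :
    sceTransformKernel X A n = A.indicator fun t => optimalFactor n ‖empiricalCharFun X n t‖ := by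
  ext t
  simp only [sceTransformKernel, Set.indicator, optimalFactor, norm_mul, Complex.norm_natCast,
    ecf_eq_empiricalCharFun]

/-- The Fourier transform of the estimator, which estimates the characteristic function of the
sample. -/
noncomputable def sceFourier (X : ℕ → Plane) (A : Set Plane) (n : ℕ) (t : Plane) : ℂ :=
  sceTransformKernel X A n t * empiricalCharFun X n t

lemma eqOn_sceFourier_zero : Set.EqOn (sceFourier X A n) 0 Aᶜ := fun t ht => by
  rw [sceFourier, sceTransformKernel_eq_indicator, Set.indicator_of_notMem ht, Complex.ofReal_zero,
    zero_mul, Pi.zero_apply]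

lemma norm_sceFourier_sub_le (hn : 2 ≤ n) {t : Plane} (ht : t ∈ A) :
    ‖sceFourier X A n t - empiricalCharFun X n t‖ ≤ 4 / √n := by
  rw [sceFourier, ← sub_one_mul, norm_mul, sceTransformKernel_eq_indicator, Set.indicator_of_mem ht,
    ← Complex.ofReal_one, ← Complex.ofReal_sub, Complex.norm_real]
  exact abs_optimalFactor_sub_one_mul_le_four_div_sqrt hn (norm_nonneg _)
    (norm_empiricalCharFun_le_one X n t)

lemma integrable_sceTransformKernel (hA : MeasurableSet A) (hA_vol : volume A ≠ ∞) (hn : 2 ≤ n) :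
    Integrable fun t => (sceTransformKernel X A n t : ℂ) := by
  have hκ : Integrable (sceTransformKernel X A n) := by
    rw [sceTransformKernel_eq_indicator, integrable_indicator_iff hA]
    exact Measure.integrableOn_of_bounded hA_vol
      ((measurable_optimalFactor n).comp (by fun_prop)).aestronglyMeasurable
      (ae_of_all _ fun t => abs_optimalFactor_le hn _)
  exact hκ.ofReal

lemma integrable_sceFourier (hA : MeasurableSet A) (hA_vol : volume A ≠ ∞) (hn : 2 ≤ n) :
    Integrable (sceFourier X A n) :=
  (integrable_sceTransformKernel hA hA_vol hn).mul_bdd (c := 1)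
    (continuous_empiricalCharFun X n).aestronglyMeasurable
    (ae_of_all _ fun t => norm_empiricalCharFun_le_one X n t)

lemma sce_eq_charInversion (hA : MeasurableSet A) (hA_vol : volume A ≠ ∞) (hn : 2 ≤ n) :
    sce X A n = charInversion (sceFourier X A n) := by
  ext x
  unfold sceFourier
  rw [← inv_mul_sum_charInversion_sub (integrable_sceTransformKernel hA hA_vol hn)]
  simp only [sce, sceKernel, charInversion, finrank_euclideanSpace_fin]

lemma integral_norm_sceFourier_sub_le {φ : Plane → ℂ} (hφ : Integrable φ)
    {D : Set Plane} (hA : MeasurableSet A) (hAD : A ⊆ D) (hD_vol : volume D ≠ ∞) (hn : 2 ≤ n) :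
    ∫ t, ‖sceFourier X A n t - φ t‖ ≤
      (∫ t in D, ‖empiricalCharFun X n t - φ t‖) + volume.real D * (4 / √n) +
        ∫ t in Aᶜ, ‖φ t‖ :=
  integral_norm_sub_le_of_eqOn_compl_zero hA hAD hD_vol
    (integrable_sceFourier hA (measure_ne_top_of_subset hAD hD_vol) hn)
    (Measure.integrableOn_of_bounded hD_vol (continuous_empiricalCharFun X n).aestronglyMeasurable
      (ae_of_all _ fun t => norm_empiricalCharFun_le_one X n t))
    hφ (by positivity) (fun t ht => norm_sceFourier_sub_le hn ht) eqOn_sceFourier_zero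

lemma tendstoUniformly_sce {A D : ℕ → Set Plane} {φ : Plane → ℂ} (hφ : Integrable φ)
    (hA : ∀ n, MeasurableSet (A n)) (hAD : ∀ᶠ n in atTop, A n ⊆ D n)
    (hD_vol : Tendsto (fun n : ℕ => volume (D n) / ENNReal.ofReal √n) atTop (𝓝 0))
    (hA_compl : ∀ r : ℝ, Tendsto (fun n => volume ((A n)ᶜ ∩ Metric.ball 0 r)) atTop (𝓝 0))
    (hC : Tendsto (fun n => ∫ t in D n, ‖empiricalCharFun X n t - φ t‖) atTop (𝓝 0)) :
    TendstoUniformly (fun n => sce X (A n) n) (charInversion φ) atTop := by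
  have hgood : ∀ᶠ n in atTop, 2 ≤ n ∧ A n ⊆ D n ∧ volume (D n) ≠ ∞ := by
    filter_upwards [eventually_ge_atTop 2, hAD, hD_vol.eventually_ne ENNReal.zero_ne_top]
      with n hn hsub hfin
    exact ⟨hn, hsub, fun htop => hfin (htop ▸ ENNReal.top_div_of_ne_top ENNReal.ofReal_ne_top)⟩
  have hrate : Tendsto (fun n : ℕ => volume.real (D n) * (4 / √n)) atTop (𝓝 0) := by
    have h := ((ENNReal.tendsto_toReal ENNReal.zero_ne_top).comp hD_vol).const_mul 4
    rw [ENNReal.toReal_zero, mul_zero] at h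
    refine h.congr fun n => ?_
    rw [Function.comp_apply, ENNReal.toReal_div, ENNReal.toReal_ofReal (Real.sqrt_nonneg _),
      measureReal_def]
    ring
  have hbound :=
    (hC.add hrate).add (tendsto_setIntegral_norm_of_tendsto_measure_inter_ball hφ 0 hA_compl)
  rw [add_zero, add_zero] at hbound
  have hsce : ∀ᶠ n in atTop, sce X (A n) n = charInversion (sceFourier X (A n) n) :=
    hgood.mono fun n ⟨hn, hsub, hfin⟩ =>
      sce_eq_charInversion (hA n) (measure_ne_top_of_subset hsub hfin) hn
  have hint : ∀ᶠ n in atTop, Integrable (sceFourier X (A n) n) :=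
    hgood.mono fun n ⟨hn, hsub, hfin⟩ =>
      integrable_sceFourier (hA n) (measure_ne_top_of_subset hsub hfin) hn
  have hlim : Tendsto (fun n => ∫ t, ‖sceFourier X (A n) n t - φ t‖) atTop (𝓝 0) :=
    squeeze_zero' (Eventually.of_forall fun n => integral_nonneg fun t => norm_nonneg _)
      (hgood.mono fun n ⟨hn, hsub, hfin⟩ =>
        integral_norm_sceFourier_sub_le hφ (hA n) hsub hfin hn) hbound
  exact (tendstoUniformly_congr hsce).2 (tendstoUniformly_charInversion hint hφ hlim)

lemma ae_tendstoUniformly_sce {Ω : Type*} [MeasurableSpace Ω] {P : Measure Ω}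
    [IsProbabilityMeasure P] {f : Plane → ℝ} (hf_meas : Measurable f) (hf_nonneg : ∀ x, 0 ≤ f x)
    (hf : Integrable f) (hφ : Integrable (densityFourier f)) {X : ℕ → Ω → Plane}
    (hX : ∀ j, Measurable (X j)) (hX_indep : iIndepFun X P)
    (hX_law : ∀ j, P.map (X j) = densityLaw f) {A : ℕ → Ω → Set Plane}
    (hA : ∀ n ω, MeasurableSet (A n ω)) {D : ℕ → Set Plane} (hD : ∀ n, MeasurableSet (D n))
    (hAD : ∀ᵐ ω ∂P, ∀ᶠ n in atTop, A n ω ⊆ D n)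
    (hD_vol : Tendsto (fun n : ℕ => volume (D n) / ENNReal.ofReal √n) atTop (𝓝 0))
    (hA_compl : ∀ᵐ ω ∂P, ∀ r : ℝ,
      Tendsto (fun n => volume ((A n ω)ᶜ ∩ Metric.ball 0 r)) atTop (𝓝 0)) :
    ∀ᵐ ω ∂P, TendstoUniformly (fun n => sce (fun j => X j ω) (A n ω) n)
      (charInversion (densityFourier f)) atTop := by
  obtain ⟨C, hC⟩ := exists_densityLaw_le_smul_volume hf hφ
  have hecf := ae_tendsto_integral_norm_empiricalCharFun_sub hX hX_indep hX_law hC hD hD_vol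
  rw [← densityFourier_eq_charFun hf_meas hf_nonneg] at hecf
  filter_upwards [hecf, hAD, hA_compl] with ω hω hωD hω_compl
  exact tendstoUniformly_sce hφ (fun n => hA n ω) hωD hD_vol hω_compl hω

end SelfConsistentEstimator

theorem theorem1 {Ω : Type*} [MeasurableSpace Ω] (P : Measure Ω) [IsProbabilityMeasure P]
    -- the true density
    (f : Plane → ℝ) (hf_meas : Measurable f) (hf_nonneg : ∀ x, 0 ≤ f x)
    -- the i.i.d. sample
    (X : ℕ → Ω → Plane) (hX_meas : ∀ j, Measurable (X j)) (hX_indep : iIndepFun X P)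
    (hX_law : ∀ j, P.map (X j) = densityLaw f)
    -- assumptions on the density
    (hf_sq : MemLp f 2 volume) (hφ : Integrable (densityFourier f) volume)
    -- acceptable frequencies `A n ω`, inside a non-random window `D n`
    -- (for non-random acceptable frequencies, `D n = A n ω`)
    (A : ℕ → Ω → Set Plane) (hA_meas : ∀ n ω, MeasurableSet (A n ω))
    (D : ℕ → Set Plane) (hD_meas : ∀ n, MeasurableSet (D n))
    (hAD : ∀ᵐ ω ∂P, ∀ᶠ n in atTop, A n ω ⊆ D n)
    (hA_vol : ∀ᵐ ω ∂P, Tendsto (fun n => volume (A n ω)) atTop (𝓝 ∞))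
    (hD_vol : Tendsto (fun n : ℕ => volume (D n) / ENNReal.ofReal (Real.sqrt n)) atTop (𝓝 0))
    (hA_compl : ∀ᵐ ω ∂P, ∀ R : ℝ,
      Tendsto (fun n => volume ((A n ω)ᶜ ∩ Metric.ball 0 R)) atTop (𝓝 0)) :
    (∃ N : Set Plane, volume N = 0 ∧ ∀ᵐ ω ∂P, ∀ x ∉ N,
      Tendsto (fun n => sce (fun j => X j ω) (A n ω) n x) atTop (𝓝 (f x : ℂ))) ∧
    (ContinuousOn f (densitySupport f) →
      ∀ᵐ ω ∂P, TendstoUniformlyOn (fun n x => sce (fun j => X j ω) (A n ω) n x)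
        (fun x => (f x : ℂ)) atTop (densitySupport f)) ∧
    (ContinuousOn f (densitySupport f) → (∀ x ∉ densitySupport f, f x = 0) →
      ∀ᵐ ω ∂P, TendstoUniformly (fun n x => sce (fun j => X j ω) (A n ω) n x)
        (fun x => (f x : ℂ)) atTop) := by
  have hprob : IsProbabilityMeasure (densityLaw f) :=
    hX_law 0 ▸ Measure.isProbabilityMeasure_map (hX_meas 0).aemeasurable
  have hf := integrable_of_isFiniteMeasure_densityLaw hf_meas hf_nonneg
  have huni := ae_tendstoUniformly_sce hf_meas hf_nonneg hf hφ hX_meas hX_indep hX_law hA_meas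
    hD_meas hAD hD_vol hA_compl
  refine ⟨⟨{x | ¬ (f x : ℂ) = charInversion (densityFourier f) x},
    ae_eq_charInversion_densityFourier hf hφ, ?_⟩, fun hfc => ?_, fun hfc hf0 => ?_⟩
  · filter_upwards [huni] with ω hω x hx
    rw [not_not.1 hx]
    exact hω.tendsto_at x
  · filter_upwards [huni] with ω hω
    exact hω.tendstoUniformlyOn.congr_right (eqOn_charInversion_densitySupport hf hφ hfc)
  · rwa [charInversion_densityFourier_eq hf hφ hfc hf0] at huni
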